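/- A linear multistep (LM) method with $k$ steps is given by real coefficients $\alpha_1,\dots,\alpha_k$ and $\beta_0,\dots,\beta_k$, through $$u_n=\sum_{j=1}^k\alpha_j u_{n-j}+h\sum_{j=0}^k\beta_j f(u_{n-j}).$$ It is explicit if $\beta_0=0$. It has order of accuracy $p$ if $\sum_{j=1}^k\alpha_j=1$ and, with the convention $0^0=1$, $$\sum_{j=1}^k\left(j^m\alpha_j-mj^{m-1}\beta_j\right)-m\,0^{m-1}\beta_0=0\qquad\text{for }1\le m\le p.$$ Its SSP coefficient is $$\mathcal C=\min_{1\le j\le k,\ \beta_j\neq0}\alpha_j/\beta_j$$ if all $\alpha_j$ and $\beta_j$ are nonnegative (with $\min\emptyset=+\infty$), and $\mathcal C=0$ otherwise. Let $\mathcal C_{\mathrm{exp}}(k,p)\in[0,\infty]$ be the supremum of $\mathcal C$ over all explicit LM methods with $k$ steps and order of accuracy $p$ (with $\sup\emptyset=0$). **Theorem.** Let $k$ and $p$ be positive integers such that $$k>\sqrt{\frac{p^2(p^2-1)}{6}\cdot\left\lfloor\frac{p+2}{2}\right\rfloor}.$$ Then $\mathcal C_{\mathrm{exp}}(k,p)>0$;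 that is, there exists an explicit LM method with $k$ steps, order of accuracy $p$ and $\mathcal C>0$. -/

import Mathlib

open scoped ENNReal

/-- A linear multistep method with `k` steps,
`u_n = ∑_{j=1}^k α_j u_{n-j} + h ∑_{j=0}^k β_j f(u_{n-j})`, given by its coefficients:
`α i` is `α_{i+1}` for `i : Fin k`, and `β j` is `β_j` for `j : Fin (k + 1)`
(so that `β i.succ` is `β_{i+1}`). -/
@[ext]
structure LinearMultistepMethod (k : ℕ) where
  α : Fin k → ℝ
  β : Fin (k + 1) → ℝ

namespace LinearMultistepMethod

variable {k : ℕ}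

/-- The method is explicit: `β_0 = 0`. -/
def IsExplicit (M : LinearMultistepMethod k) : Prop :=
  M.β 0 = 0

/-- The method is consistent of order (of accuracy) `p`: `∑_{j=1}^k α_j = 1` and, for
`1 ≤ m ≤ p`, `∑_{j=1}^k (j^m α_j - m j^{m-1} β_j) - m 0^{m-1} β_0 = 0`, where `0^0 = 1`. -/
def HasOrder (M : LinearMultistepMethod k) (p : ℕ) : Prop :=
  ∑ i : Fin k, M.α i = 1 ∧
  ∀ m : ℕ, 1 ≤ m → m ≤ p →
    ∑ i : Fin k, (((i : ℕ) + 1 : ℝ) ^ m * M.α i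
        - (m : ℝ) * ((i : ℕ) + 1 : ℝ) ^ (m - 1) * M.β i.succ)
      - (m : ℝ) * (0 : ℝ) ^ (m - 1) * M.β 0 = 0

/-- All coefficients of the method are nonnegative. -/
def Nonneg (M : LinearMultistepMethod k) : Prop :=
  (∀ i, 0 ≤ M.α i) ∧ ∀ j, 0 ≤ M.β j

open Classical in
/-- The SSP coefficient (threshold factor): the minimum of `α_j / β_j` over `1 ≤ j ≤ k` with
`β_j ≠ 0` if all coefficients are nonnegative (`∞` if there is no such `j`), and `0` otherwise. -/
noncomputable def sspCoeff (M : LinearMultistepMethod k) : ℝ≥0∞ :=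
  if M.Nonneg then ⨅ (i : Fin k) (_ : M.β i.succ ≠ 0), ENNReal.ofReal (M.α i / M.β i.succ)
  else 0

end LinearMultistepMethod

/-- The optimal SSP coefficient of explicit linear multistep methods with `k` steps and order of
accuracy `p`: the supremum of the SSP coefficients of all these methods (`0` if there are none). -/
noncomputable def sspCoeffExp (k p : ℕ) : ℝ≥0∞ :=
  ⨆ (M : LinearMultistepMethod k) (_ : M.IsExplicit) (_ : M.HasOrder p), M.sspCoeff

/-! Prescribing that all coefficients except `β_0` be positive turns the order conditions into a
cone problem. By separation, a solution exists unless some nonzero polynomial q of degree at most p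
satisfies q(0) ≤ 0 and, at j = 1, …, k, q(j) ≥ 0 and q'(j) ≤ 0. Such a q is excluded as follows.

Let D be the oscillation of q on [0, k]. Since q(0) ≤ 0 ≤ q(k), D is at most the total increase of
q, the integral of the positive part of q'. As q' ≤ 0 at the integers 1, …, k, it can be positive
only inside unit intervals, and each of them costs two roots of q' - ε (one for (0, 1)). If |q''| ≤
M, such an interval contributes at most M/4 (M/2 for (0, 1)), so D ≤ (M/4)⌊(p+2)/2⌋
(`integral_max_derivative_le`). Markov's inequality for the second derivative, rescaled to [0, k],
gives M = (2/k)²(D/2)p²(p²-1)/3. If D > 0, together these contradict the lower bound on k; if D = 0,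
then q = 0.

The Markov inequality is proved in two regimes: by interpolation at Chebyshev nodes near the
endpoints, and by Bernstein-type inequalities, which have room to spare, elsewhere. -/

open Polynomial

/-! ### Second derivatives near an endpoint, by interpolation at Chebyshev nodes -/

/-- For a real-rooted polynomial at a point to the right of all its roots: positivity of the
value and first two derivatives, and the Laguerre-type inequality `g g'' ≤ g' ^ 2`. -/
theorem Lagrange.eval_nodal_derivatives_of_lt {ι : Type*} (s : Finset ι)
    (v : ι → ℝ) (x : ℝ) (h : ∀ i ∈ s, v i < x) :
    0 < (Lagrange.nodal s v).eval x ∧ 0 ≤ (derivative (Lagrange.nodal s v)).eval x ∧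
      0 ≤ (derivative (derivative (Lagrange.nodal s v))).eval x ∧
      (Lagrange.nodal s v).eval x * (derivative (derivative (Lagrange.nodal s v))).eval x ≤
        (derivative (Lagrange.nodal s v)).eval x ^ 2 := by
  classical
  induction s using Finset.induction_on with
  | empty => simp
  | insert a s ha ih =>
    obtain ⟨h0, h1, h2, h3⟩ := ih fun i hi => h i (Finset.mem_insert_of_mem hi)
    have hd : 0 < x - v a := sub_pos.2 (h a (Finset.mem_insert_self _ _))
    rw [Lagrange.nodal_insert_eq_nodal ha]
    set g := Lagrange.nodal s v
    simp only [derivative_mul, derivative_sub, derivative_X, derivative_C, sub_zero, one_mul,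
      derivative_add, eval_add, eval_mul, eval_sub, eval_X, eval_C]
    set d := x - v a
    set g0 := eval x g
    set g1 := eval x (derivative g)
    set g2 := eval x (derivative (derivative g))
    refine ⟨by positivity, by positivity, by positivity, ?_⟩
    nlinarith [mul_le_mul_of_nonneg_left h3 (sq_nonneg d), sq_nonneg g0]

namespace Polynomial.Chebyshev

open Lagrange

/-- Both sides have degree n + 1 and the same leading coefficient, and both vanish at the n + 1
nodes cos(iπ/n), so their difference has too many roots. -/
theorem X_sq_sub_one_mul_derivative_T {n : ℕ} (hn : 1 ≤ n) :
    (X ^ 2 - 1) * derivative (T ℝ n) =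
      Polynomial.C ((n : ℝ) * 2 ^ (n - 1)) * nodal (Finset.range (n + 1)) (node n) := by
  have hTd : (derivative (T ℝ n)).natDegree = n - 1 := by
    rw [natDegree_derivative, natDegree_T]; simp
  have hlc : (derivative (T ℝ n)).leadingCoeff = (n : ℝ) * 2 ^ (n - 1) := by
    rw [leadingCoeff, hTd, coeff_derivative, Nat.sub_add_cancel hn]
    have : (T ℝ n).coeff n = 2 ^ (n - 1) := by
      have := leadingCoeff_T ℝ n
      rwa [leadingCoeff, natDegree_T, Int.natAbs_natCast] at this
    rw [this]; push_cast [Nat.cast_sub hn]; ring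
  have hm : (X ^ 2 - 1 : ℝ[X]).Monic := by
    have := monic_X_pow_sub_C (1 : ℝ) (two_ne_zero); simpa using this
  have hc : (n : ℝ) * 2 ^ (n - 1) ≠ 0 := by positivity
  have h2 : (X ^ 2 - 1 : ℝ[X]).natDegree = 2 := by
    have := natDegree_X_pow_sub_C (R := ℝ) (n := 2) (r := 1); simpa using this
  have hTne : derivative (T ℝ n) ≠ 0 := by
    intro h; rw [h] at hlc; simp at hlc; rcases hlc with h | h <;> simp_all
  have hne : (X ^ 2 - 1) * derivative (T ℝ n) ≠ 0 := mul_ne_zero hm.ne_zero hTne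
  have hdeg : ((X ^ 2 - 1) * derivative (T ℝ n)).natDegree = n + 1 := by
    rw [natDegree_mul hm.ne_zero hTne, h2, hTd]; omega
  refine eq_of_degree_sub_lt_of_eval_index_eq (s := Finset.range (n + 1)) (v := node n)
    (strictAntiOn_node n).injOn ?_ ?_
  · refine (degree_sub_lt_left ?_ hne ?_).trans_eq ?_
    · rw [degree_C_mul hc, degree_nodal, degree_eq_natDegree hne, hdeg]; simp
    · rw [leadingCoeff_mul, hm.leadingCoeff, hlc, leadingCoeff_mul, nodal_monic.leadingCoeff,
        leadingCoeff_C, one_mul, mul_one]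
    · rw [degree_eq_natDegree hne, hdeg]; simp
  · intro i hi
    rw [eval_mul, eval_mul, eval_nodal_at_node hi, mul_zero]
    rw [T_derivative_eq_U]
    have hU := U_real_cos ((i * Real.pi / n : ℝ)) ((n : ℤ) - 1)
    have h3 : (((n : ℤ) - 1 : ℤ) + 1 : ℝ) * (i * Real.pi / n) = i * Real.pi := by
      have : (n : ℝ) ≠ 0 := by positivity
      push_cast; field_simp; ring
    rw [h3, Real.sin_nat_mul_pi] at hU
    have hs := Real.sin_sq_add_cos_sq (i * Real.pi / n : ℝ)
    simp only [node, eval_sub, eval_pow, eval_X, eval_one, eval_mul, eval_intCast]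
    linear_combination (-(n : ℝ)) * Real.sin (i * Real.pi / n) * hU +
      (n : ℝ) * eval (Real.cos (i * Real.pi / n)) (U ℝ (n - 1)) * hs

theorem node_le_one_of_pos {n i : ℕ} (hi : 1 ≤ i) (hin : i ≤ n) : node n i ≤ node n 1 := by
  rcases hi.eq_or_lt with rfl | h
  · rfl
  · exact (node_lt hin h).le

/-- The second derivative of the full nodal polynomial is nonnegative to the right of its second
largest root. -/
theorem eval_derivative_derivative_nodal_nonneg {n : ℕ} (hn : 2 ≤ n) {x : ℝ}
    (hx : node n 1 < x) :
    0 ≤ (derivative (derivative (nodal (Finset.range (n + 1)) (node n)))).eval x := by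
  have hn1 : 1 ≤ n := by omega
  have hc : 0 < (n : ℝ) * 2 ^ (n - 1) := by positivity
  have hx0 : 0 ≤ x := by
    refine le_trans ?_ hx.le
    refine Real.cos_nonneg_of_mem_Icc ⟨?_, ?_⟩
    · have := Real.pi_pos
      exact le_trans (by linarith) (show (0 : ℝ) ≤ _ by positivity)
    · have : (2 : ℝ) ≤ n := by exact_mod_cast hn
      rw [Nat.cast_one, one_mul]
      have := Real.pi_pos
      gcongr
  have key := X_sq_sub_one_mul_derivative_T hn1
  have hω : nodal (Finset.range (n + 1)) (node n) = (X ^ 2 - 1) * nodal (Finset.Ioo 0 n) (node n) := by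
    have h1 : Finset.range (n + 1) = insert 0 (insert n (Finset.Ioo 0 n)) := by
      ext j; simp; omega
    rw [h1, nodal_insert_eq_nodal (by simp; omega), nodal_insert_eq_nodal (by simp), node_eq_one,
      node_eq_neg_one (by omega)]
    simp; ring
  have hm : (X ^ 2 - 1 : ℝ[X]) ≠ 0 := by
    have := monic_X_pow_sub_C (1 : ℝ) (two_ne_zero)
    simpa using this.ne_zero
  have hT : derivative (T ℝ n) = Polynomial.C ((n : ℝ) * 2 ^ (n - 1)) * nodal (Finset.Ioo 0 n) (node n) := by
    rw [hω] at key
    exact mul_left_cancel₀ hm (key.trans (by ring))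
  obtain ⟨h0, h1, -, -⟩ := eval_nodal_derivatives_of_lt (Finset.Ioo 0 n) (node n) x fun i hi => by
    rw [Finset.mem_Ioo] at hi
    exact (node_le_one_of_pos (by omega) (by omega)).trans_lt hx
  have hT1 : 0 ≤ (derivative (T ℝ n)).eval x := by
    rw [hT, eval_mul, eval_C]; positivity
  have hT2 : 0 ≤ (derivative (derivative (T ℝ n))).eval x := by
    rw [hT, derivative_C_mul, eval_mul, eval_C]; positivity
  have ode := one_sub_X_sq_mul_iterate_derivative_T_eval (R := ℝ) n 1 x
  simp only [Function.iterate_succ, Function.iterate_zero, Function.comp, id] at ode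
  have k2 := congrArg (fun f => eval x (derivative (derivative f))) key
  simp only [derivative_mul, derivative_add, derivative_sub, derivative_one, derivative_C,
    derivative_X_pow, eval_add, eval_mul, eval_sub, eval_pow, eval_X, eval_C, eval_one, zero_mul,
    zero_add, sub_zero] at k2
  norm_num at k2 ode
  -- Differentiating (x² - 1)T' twice leaves a T''' term, which the differentiated Chebyshev
  -- equation eliminates; the remaining coefficients are nonnegative.
  have : ((n : ℝ) * 2 ^ (n - 1)) *
      (derivative (derivative (nodal (Finset.range (n + 1)) (node n)))).eval x =
      ((n : ℝ) ^ 2 + 1) * (derivative (T ℝ n)).eval x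
        + x * (derivative (derivative (T ℝ n))).eval x := by
    linear_combination -k2 - ode
  have h3 : 0 ≤ ((n : ℝ) * 2 ^ (n - 1)) *
      (derivative (derivative (nodal (Finset.range (n + 1)) (node n)))).eval x := by
    rw [this]; positivity
  exact nonneg_of_mul_nonneg_right h3 hc

/-- This fixes the signs of the interpolation weights for P''(x). For i = 0 all remaining roots lie
left of x. Otherwise the root 1 may lie to the right, and the sign is deduced from that of the full
nodal polynomial and the Laguerre-type inequality. -/
theorem eval_derivative_derivative_nodal_erase_nonneg {n i : ℕ} (hn : 2 ≤ n) (hi : i ≤ n) {x : ℝ}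
    (hx : node n 1 < x) (hx1 : x ≤ 1) :
    0 ≤ (derivative (derivative (nodal ((Finset.range (n + 1)).erase i) (node n)))).eval x := by
  have hlt : ∀ j ∈ Finset.Icc 1 n, node n j < x := fun j hj => by
    rw [Finset.mem_Icc] at hj
    exact (node_le_one_of_pos hj.1 hj.2).trans_lt hx
  rcases Nat.eq_zero_or_pos i with rfl | hi0
  · have : (Finset.range (n + 1)).erase 0 = Finset.Icc 1 n := by ext j; simp; omega
    rw [this]
    exact (eval_nodal_derivatives_of_lt _ _ x hlt).2.2.1
  have hS : (Finset.range (n + 1)).erase i = insert 0 ((Finset.Icc 1 n).erase i) := by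
    ext j; simp; omega
  have hR : Finset.range (n + 1) = insert 0 (insert i ((Finset.Icc 1 n).erase i)) := by
    ext j; simp; omega
  have hω := eval_derivative_derivative_nodal_nonneg hn hx
  rw [hR, nodal_insert_eq_nodal (by simp; omega), nodal_insert_eq_nodal (by simp),
    node_eq_one] at hω
  rw [hS, nodal_insert_eq_nodal (by simp), node_eq_one]
  obtain ⟨h0, h1, h2, h3⟩ := eval_nodal_derivatives_of_lt ((Finset.Icc 1 n).erase i) (node n) x
    fun j hj => hlt j (Finset.mem_of_mem_erase hj)
  have hd : 0 < x - node n i := sub_pos.2 (hlt i (by simp; omega))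
  set g := nodal ((Finset.Icc 1 n).erase i) (node n)
  simp only [derivative_mul, derivative_sub, derivative_X, derivative_C, sub_zero, one_mul,
    derivative_add, eval_add, eval_mul, eval_sub, eval_X, eval_C] at hω ⊢
  set d := x - node n i
  set g0 := eval x g
  set g1 := eval x (derivative g)
  set g2 := eval x (derivative (derivative g))
  set e := 1 - x with he
  have hx' : x - 1 = -e := by ring
  have he0 : 0 ≤ e := by linarith
  rw [hx'] at hω ⊢
  -- If the claim fails, `hω` forces e g' ≤ g. With g g'' ≤ g'² this gives e g'' ≤ g', against 2g' <
  -- e g''.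
  by_contra! hcon
  have hA : 2 * g1 < e * g2 := by linarith
  have hB : e * g1 ≤ g0 := by nlinarith
  have hC : e * g2 * g0 ≤ e * g1 * g1 := by nlinarith
  have hD : e * g1 * g1 ≤ g0 * g1 := by nlinarith
  nlinarith

/-- Near the end points, the second derivative of a polynomial bounded by one is dominated by that
of the Chebyshev polynomial. -/
theorem eval_derivative_derivative_le_of_node_lt {n : ℕ} (hn : 2 ≤ n) {P : ℝ[X]}
    (hdeg : P.degree ≤ n) (hP : ∀ x ∈ Set.Icc (-1) 1, |P.eval x| ≤ 1) {x : ℝ}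
    (hx : node n 1 < x) (hx1 : x ≤ 1) :
    (derivative (derivative P)).eval x ≤ (derivative (derivative (T ℝ n))).eval x := by
  let w : ℕ → ℝ := fun i => (∏ j ∈ (Finset.range (n + 1)).erase i, (node n i - node n j))⁻¹
  let c : ℕ → ℝ := fun i => w i *
    (derivative (derivative (nodal ((Finset.range (n + 1)).erase i) (node n)))).eval x
  have hsum : ∀ Q : ℝ[X], Q.degree ≤ n →
      sumNodes n c Q = (derivative (derivative Q)).eval x := by
    intro Q hQ
    have hlt : Q.degree < (Finset.range (n + 1)).card := by
      rw [Finset.card_range]; grw [hQ]; norm_cast; simp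
    have hQ' := interpolate_eq_sum (s := Finset.range (n + 1)) (v := node n)
      (r := fun i => Q.eval (node n i))
    rw [← eq_interpolate (strictAntiOn_node n).injOn hlt] at hQ'
    conv_rhs => rw [hQ']
    rw [sumNodes, ← Nat.range_succ_eq_Iic, derivative_sum, derivative_sum, eval_finsetSum]
    refine Finset.sum_congr rfl fun i hi => ?_
    rw [← nodal_eq, derivative_C_mul, derivative_C_mul, eval_mul, eval_C]
    simp only [c, w]
    ring
  rw [← hsum P hdeg, ← hsum (T ℝ n) (by simp)]
  -- The weights alternate in sign exactly as T does at the nodes, so T maximises the functional.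
  refine sumNodes_le_sumNodes_T (fun i hi => ?_) hP
  have h1 := inv_pos_of_pos (zero_lt_prod_node_sub_node hi)
  rw [mul_inv, ← inv_pow, inv_neg_one] at h1
  rw [← mul_assoc]
  exact mul_nonneg h1.le (eval_derivative_derivative_nodal_erase_nonneg hn hi hx hx1)

end Polynomial.Chebyshev

/-! ### Bernstein-type inequalities and Markov's inequality for the second derivative -/

namespace Polynomial.Chebyshev

/-- The even part of a translate of `P (cos φ)` is again a polynomial in `cos φ`. -/
theorem exists_eval_cos_add_add_eval_cos_sub (n : ℕ) (P : ℝ[X]) (hP : P.natDegree ≤ n) (a : ℝ) :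
    ∃ G : ℝ[X], G.natDegree ≤ n ∧ ∀ φ : ℝ,
      P.eval (Real.cos (a + φ)) + P.eval (Real.cos (a - φ)) = 2 * G.eval (Real.cos φ) := by
  have hmem : P ∈ degreeLT ℝ (n + 1) := by
    rw [mem_degreeLT]
    exact (natDegree_le_iff_degree_le.1 hP).trans_lt (by exact_mod_cast Nat.lt_succ_self n)
  rw [← Sequence.span_degreeLT (chebyshevTsequence ℝ) (by simp)] at hmem
  clear hP
  induction hmem using Submodule.span_induction with
  | mem x h =>
    obtain ⟨k, hk, rfl⟩ := h
    refine ⟨Polynomial.C (Real.cos (k * a)) * T ℝ k, ?_, fun φ => ?_⟩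
    · refine (natDegree_C_mul_le _ _).trans ?_
      simpa [Nat.lt_succ_iff] using hk
    · change eval _ (T ℝ k) + eval _ (T ℝ k) = _
      rw [T_real_cos, T_real_cos, eval_mul, eval_C, T_real_cos, mul_add, mul_sub, Int.cast_natCast,
        Real.cos_add, Real.cos_sub]
      ring
  | zero => exact ⟨0, by simp, by simp⟩
  | add P Q _ _ h1 h2 =>
    obtain ⟨G, hG, h1⟩ := h1
    obtain ⟨H, hH, h2⟩ := h2
    refine ⟨G + H, (natDegree_add_le _ _).trans (max_le hG hH), fun φ => ?_⟩
    simp only [eval_add]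
    linear_combination h1 φ + h2 φ
  | smul c P _ h1 =>
    obtain ⟨G, hG, h1⟩ := h1
    refine ⟨c • G, (natDegree_smul_le _ _).trans hG, fun φ => ?_⟩
    simp only [eval_smul, smul_eq_mul]
    linear_combination c * h1 φ

theorem abs_eval_iterate_derivative_one_le {n : ℕ} {P : ℝ[X]} (hdeg : P.natDegree ≤ n)
    (hP : ∀ x ∈ Set.Icc (-1) 1, |P.eval x| ≤ 1) (k : ℕ) :
    |(derivative^[k] P).eval 1| ≤ (derivative^[k] (T ℝ n)).eval 1 := by
  have h1 := eval_iterate_derivative_le_of_forall_abs_le_one (n := n) (k := k) le_rfl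
    (natDegree_le_iff_degree_le.1 hdeg) hP
  have h2 := eval_iterate_derivative_le_of_forall_abs_le_one (n := n) (P := -P) (k := k) le_rfl
    (by rw [degree_neg]; exact natDegree_le_iff_degree_le.1 hdeg) (by simpa using hP)
  rw [iterate_derivative_neg, eval_neg] at h2
  exact abs_le.2 ⟨by linarith, h1⟩

/-- The second order Bernstein inequality for the cosine polynomial `P (cos θ)`. -/
theorem abs_bernstein_second_le {n : ℕ} {P : ℝ[X]} (hdeg : P.natDegree ≤ n)
    (hP : ∀ x ∈ Set.Icc (-1) 1, |P.eval x| ≤ 1) (a : ℝ) :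
    |Real.sin a ^ 2 * (derivative (derivative P)).eval (Real.cos a)
      - Real.cos a * (derivative P).eval (Real.cos a)| ≤ (n : ℝ) ^ 2 := by
  -- Symmetrising about a moves the problem to an endpoint: the second θ-derivative of P(cos θ) at a
  -- equals -G'(1), and |G'(1)| ≤ T'(1) = n².
  obtain ⟨G, hG, h⟩ := exists_eval_cos_add_add_eval_cos_sub n P hdeg a
  have hcos : ∀ y : ℝ, Real.cos y ∈ Set.Icc (-1 : ℝ) 1 := fun y =>
    ⟨Real.neg_one_le_cos y, Real.cos_le_one y⟩
  have hG1 : ∀ x ∈ Set.Icc (-1) 1, |G.eval x| ≤ 1 := by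
    intro x hx
    have h1 := h (Real.arccos x)
    rw [Real.cos_arccos hx.1 hx.2] at h1
    have h2 := abs_le.1 (hP _ (hcos (a + Real.arccos x)))
    have h3 := abs_le.1 (hP _ (hcos (a - Real.arccos x)))
    exact abs_le.2 ⟨by linarith, by linarith⟩
  have hb := abs_eval_iterate_derivative_one_le hG hG1 1
  simp only [Function.iterate_one, derivative_T_eval_one, Int.cast_natCast] at hb
  have hd : ∀ (Q : ℝ[X]) (y : ℝ), HasDerivAt (fun z => Q.eval (Real.cos z))
      ((derivative Q).eval (Real.cos y) * -Real.sin y) y := fun Q y =>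
    (Q.hasDerivAt (Real.cos y)).comp y (Real.hasDerivAt_cos y)
  have hap : ∀ y : ℝ, HasDerivAt (fun z => a + z) 1 y := fun y => (hasDerivAt_id y).const_add a
  have ham : ∀ y : ℝ, HasDerivAt (fun z => a - z) (-1) y := fun y => (hasDerivAt_id y).const_sub a
  have h1 : ∀ y : ℝ, (derivative P).eval (Real.cos (a + y)) * -Real.sin (a + y) * 1 +
      (derivative P).eval (Real.cos (a - y)) * -Real.sin (a - y) * -1 =
      2 * ((derivative G).eval (Real.cos y) * -Real.sin y) := by
    intro y
    have e1 := ((hd P (a + y)).comp y (hap y)).add ((hd P (a - y)).comp y (ham y))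
    have e2 := (hd G y).const_mul 2
    refine e1.unique (e2.congr_of_eventuallyEq (Filter.Eventually.of_forall fun z => ?_))
    exact h z
  have hd2 : ∀ (Q : ℝ[X]) (y : ℝ), HasDerivAt (fun z => Q.eval (Real.cos z) * -Real.sin z)
      ((derivative Q).eval (Real.cos y) * -Real.sin y * -Real.sin y +
        Q.eval (Real.cos y) * -Real.cos y) y := fun Q y =>
    (hd Q y).mul (Real.hasDerivAt_sin y).neg
  have h2 : (derivative (derivative P)).eval (Real.cos a) * -Real.sin a * -Real.sin a +
        (derivative P).eval (Real.cos a) * -Real.cos a = -(derivative G).eval 1 := by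
    have ea : a = a + 0 := by ring
    have eb : a = a - 0 := by ring
    have e1 := (((hd2 (derivative P) (a + 0)).comp 0 (hap 0)).mul_const 1).add
      (((hd2 (derivative P) (a - 0)).comp 0 (ham 0)).mul_const (-1))
    have e2 := (hd2 (derivative G) 0).const_mul 2
    have := e1.unique (e2.congr_of_eventuallyEq (Filter.Eventually.of_forall fun z => h1 z))
    simp only [add_zero, sub_zero, Real.cos_zero, Real.sin_zero] at this
    linarith
  have h3 : Real.sin a ^ 2 * (derivative (derivative P)).eval (Real.cos a)
      - Real.cos a * (derivative P).eval (Real.cos a) = -(derivative G).eval 1 := by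
    linear_combination h2
  rw [h3, abs_neg]
  exact hb

/-- The mean value theorem on [a - 1/n, a + 1/n] gives a point where the bound n holds; the second
order inequality limits the change from there to a by n² · (1/n) = n. The lost factor 2 is
affordable. -/
theorem abs_bernstein_first_le {n : ℕ} (hn : 1 ≤ n) {P : ℝ[X]} (hdeg : P.natDegree ≤ n)
    (hP : ∀ x ∈ Set.Icc (-1) 1, |P.eval x| ≤ 1) (a : ℝ) :
    |Real.sin a * (derivative P).eval (Real.cos a)| ≤ 2 * (n : ℝ) := by
  have hn0 : (0 : ℝ) < n := by exact_mod_cast hn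
  have hcos : ∀ y : ℝ, Real.cos y ∈ Set.Icc (-1 : ℝ) 1 := fun y =>
    ⟨Real.neg_one_le_cos y, Real.cos_le_one y⟩
  have hd : ∀ (Q : ℝ[X]) (y : ℝ), HasDerivAt (fun z => Q.eval (Real.cos z))
      ((derivative Q).eval (Real.cos y) * -Real.sin y) y := fun Q y =>
    (Q.hasDerivAt (Real.cos y)).comp y (Real.hasDerivAt_cos y)
  have hd2 : ∀ (Q : ℝ[X]) (y : ℝ), HasDerivAt (fun z => Real.sin z * Q.eval (Real.cos z))
      (Real.cos y * Q.eval (Real.cos y) +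
        Real.sin y * ((derivative Q).eval (Real.cos y) * -Real.sin y)) y := fun Q y =>
    (Real.hasDerivAt_sin y).mul (hd Q y)
  set h : ℝ := 1 / n with hh
  have hh0 : 0 < h := by positivity
  obtain ⟨ξ, hξ, hξ'⟩ := exists_hasDerivAt_eq_slope (fun z => P.eval (Real.cos z)) _
    (show a - h < a + h by linarith) (fun y _ => (hd P y).continuousAt.continuousWithinAt)
    (fun y _ => hd P y)
  have hξ1 : |Real.sin ξ * (derivative P).eval (Real.cos ξ)| ≤ n := by
    have e : Real.sin ξ * (derivative P).eval (Real.cos ξ) =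
      -((P.eval (Real.cos (a + h)) - P.eval (Real.cos (a - h))) / (a + h - (a - h))) := by
      linear_combination -hξ'
    have e3 : a + h - (a - h) = 2 * h := by ring
    rw [e, abs_neg, abs_div, e3, abs_of_pos (show 0 < 2 * h by positivity), div_le_iff₀ (by positivity)]
    have e2 : (n : ℝ) * (2 * h) = 2 := by rw [hh]; field_simp
    rw [e2]
    have h2 := abs_le.1 (hP _ (hcos (a + h)))
    have h3 := abs_le.1 (hP _ (hcos (a - h)))
    exact abs_le.2 ⟨by linarith, by linarith⟩
  have hlip := Convex.norm_image_sub_le_of_norm_hasDerivWithin_le (s := Set.univ) (C := (n : ℝ) ^ 2)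
    (fun y _ => (hd2 (derivative P) y).hasDerivWithinAt) (fun y _ => by
      rw [Real.norm_eq_abs, ← abs_neg]
      convert abs_bernstein_second_le hdeg hP y using 2
      ring) convex_univ (Set.mem_univ ξ) (Set.mem_univ a)
  rw [Real.norm_eq_abs, Real.norm_eq_abs] at hlip
  have h4 : |a - ξ| ≤ h := abs_le.2 ⟨by linarith [hξ.2], by linarith [hξ.1]⟩
  have h5 : (n : ℝ) ^ 2 * |a - ξ| ≤ n := by
    refine (mul_le_mul_of_nonneg_left h4 (by positivity)).trans_eq ?_
    rw [hh]; field_simp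
  have h6 := abs_sub_abs_le_abs_sub (Real.sin a * (derivative P).eval (Real.cos a))
    (Real.sin ξ * (derivative P).eval (Real.cos ξ))
  linarith

theorem iterate_derivative_two_T_eval_one (n : ℕ) :
    (derivative (derivative (T ℝ n))).eval 1 = (n : ℝ) ^ 2 * ((n : ℝ) ^ 2 - 1) / 3 := by
  have := iterate_derivative_T_eval_one (R := ℝ) n 2
  simp [Finset.prod_range_succ] at this
  linarith

/-- Concavity puts sin above its chord on [0, π/3], and √3 ≥ 5/3. -/
theorem five_div_two_mul_le_sin_pi_div {n : ℕ} (hn : 3 ≤ n) :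
    5 / (2 * (n : ℝ)) ≤ Real.sin (Real.pi / n) := by
  have hn' : (3 : ℝ) ≤ n := by exact_mod_cast hn
  have hpi := Real.pi_pos
  have hc := strictConcaveOn_sin_Icc.concaveOn.2 (Set.left_mem_Icc.2 hpi.le)
    (show Real.pi / 3 ∈ Set.Icc 0 Real.pi from ⟨by positivity, by linarith⟩)
    (show (0 : ℝ) ≤ 1 - 3 / n from
    by rw [sub_nonneg, div_le_one (by linarith)]; exact hn') (show (0 : ℝ) ≤ 3 / n by positivity)
    (by ring)
  simp only [smul_eq_mul, Real.sin_zero, mul_zero, zero_add, Real.sin_pi_div_three] at hc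
  have h3 : (5 / 3 : ℝ) ≤ √3 := Real.le_sqrt_of_sq_le (by norm_num)
  have e : 3 / (n : ℝ) * (Real.pi / 3) = Real.pi / n := by field_simp
  rw [e] at hc
  refine le_trans ?_ hc
  calc 5 / (2 * (n : ℝ)) = 3 / n * ((5 / 3) / 2) := by field_simp
    _ ≤ _ := by gcongr

/-- Right of the node cos(π/n) comparison with T applies. Left of it sin a ≥ 5/(2n), and the two
Bernstein-type bounds suffice. -/
theorem eval_derivative_derivative_le_of_nonneg {n : ℕ} (hn : 3 ≤ n) {P : ℝ[X]}
    (hdeg : P.natDegree ≤ n) (hP : ∀ x ∈ Set.Icc (-1) 1, |P.eval x| ≤ 1) {x : ℝ}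
    (hx0 : 0 ≤ x) (hx1 : x ≤ 1) :
    (derivative (derivative P)).eval x ≤ (n : ℝ) ^ 2 * ((n : ℝ) ^ 2 - 1) / 3 := by
  rcases lt_or_ge (node n 1) x with hx | hx
  · refine (eval_derivative_derivative_le_of_node_lt (by omega)
      (natDegree_le_iff_degree_le.1 hdeg) hP hx hx1).trans ?_
    rw [← iterate_derivative_two_T_eval_one]
    exact (le_abs_self _).trans
      (abs_iterate_derivative_T_real_le n 2 (abs_le.2 ⟨by linarith, hx1⟩))
  · have hn' : (3 : ℝ) ≤ n := by exact_mod_cast hn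
    have h5 := five_div_two_mul_le_sin_pi_div hn
    have h50 : 0 < 5 / (2 * (n : ℝ)) := by positivity
    obtain ⟨a, ha0, hapi, rfl⟩ : ∃ a, 0 ≤ a ∧ a ≤ Real.pi ∧ Real.cos a = x :=
      ⟨Real.arccos x, Real.arccos_nonneg x, Real.arccos_le_pi x,
        Real.cos_arccos (by linarith) hx1⟩
    have hs0 := Real.sin_nonneg_of_nonneg_of_le_pi ha0 hapi
    have hs : 5 / (2 * (n : ℝ)) ≤ Real.sin a := by
      refine h5.trans (abs_le_of_sq_le_sq' ?_ hs0).2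
      rw [node, Nat.cast_one, one_mul] at hx
      have := Real.sin_sq_add_cos_sq a
      have := Real.sin_sq_add_cos_sq (Real.pi / n)
      nlinarith
    have hspos : 0 < Real.sin a := h50.trans_le hs
    have b2 := (abs_le.1 (abs_bernstein_second_le hdeg hP a)).2
    have b1 := (abs_le.1 (abs_bernstein_first_le (by omega) hdeg hP a)).2
    set D := eval (Real.cos a) (derivative (derivative P))
    set D1 := eval (Real.cos a) (derivative P)
    set s := Real.sin a
    have hD1 : Real.cos a * D1 * s ≤ 2 * n := by
      have := mul_le_mul_of_nonneg_left b1 hx0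
      have h2 : Real.cos a * (2 * n) ≤ 1 * (2 * n) := by gcongr
      nlinarith
    have hns : 5 / 2 ≤ n * s := by
      rw [div_le_iff₀ (by positivity)] at hs
      linarith
    set B := (n : ℝ) ^ 2 * ((n : ℝ) ^ 2 - 1) / 3 with hB
    have hm : s ^ 3 * D ≤ s * n ^ 2 + 2 * n := by nlinarith
    have hfin : s * n ^ 2 + 2 * n ≤ s ^ 3 * B := by
      set y := (n : ℝ) * s with hy
      have hk : (n : ℝ) ^ 2 - 1 ≥ 8 / 9 * n ^ 2 := by nlinarith
      have e1 : s * n ^ 2 + 2 * n = n * (y + 2) := by rw [hy]; ring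
      have e2 : n * (8 / 27 * y ^ 3) ≤ s ^ 3 * B := by
        have : s ^ 3 * B = s ^ 3 * n ^ 2 / 3 * ((n : ℝ) ^ 2 - 1) := by rw [hB]; ring
        rw [this]
        calc n * (8 / 27 * y ^ 3) = s ^ 3 * n ^ 2 / 3 * (8 / 9 * n ^ 2) := by rw [hy]; ring
          _ ≤ _ := by gcongr
      rw [e1]
      refine le_trans ?_ e2
      gcongr
      -- What remains is y + 2 ≤ (8/27)y³ for y ≥ 5/2; at y = 5/2 it reads 4.5 ≤ 4.62….
      nlinarith [mul_nonneg (sub_nonneg.2 hns) (sub_nonneg.2 hns), sq_nonneg y]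
    exact le_of_mul_le_mul_left (hm.trans hfin) (by positivity)

theorem eval_derivative_derivative_le {n : ℕ} {P : ℝ[X]}
    (hdeg : P.natDegree ≤ n) (hP : ∀ x ∈ Set.Icc (-1) 1, |P.eval x| ≤ 1) {x : ℝ}
    (hx : x ∈ Set.Icc (-1) 1) :
    (derivative (derivative P)).eval x ≤ (n : ℝ) ^ 2 * ((n : ℝ) ^ 2 - 1) / 3 := by
  rcases lt_or_ge n 3 with hn | hn
  -- For n ≤ 2 the second derivative is constant, so the bound at the endpoint 1 suffices.
  · have h0 : (derivative (derivative P)).natDegree = 0 := by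
      have h1 := natDegree_derivative_le P
      have h2 := natDegree_derivative_le (derivative P)
      omega
    rw [eq_C_of_natDegree_eq_zero h0, eval_C]
    have := (le_abs_self _).trans (abs_eval_iterate_derivative_one_le hdeg hP 2)
    simp only [Function.iterate_succ, Function.iterate_zero, Function.comp, id,
      iterate_derivative_two_T_eval_one] at this
    rwa [eq_C_of_natDegree_eq_zero h0, eval_C] at this
  · rcases le_total 0 x with h0 | h0
    · exact eval_derivative_derivative_le_of_nonneg hn hdeg hP h0 hx.2
    · have h := eval_derivative_derivative_le_of_nonneg hn (P := P.comp (-X)) (x := -x)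
        (by rw [natDegree_comp]; simpa using hdeg)
        (fun y hy => by
          rw [eval_comp, eval_neg, eval_X]
          exact hP _ ⟨by linarith [hy.2], by linarith [hy.1]⟩) (by linarith) (by linarith [hx.1])
      simpa [derivative_comp, eval_comp] using h

/-- The sharp Markov inequality for the second derivative (a case of V. A. Markov's theorem). -/
theorem abs_eval_derivative_derivative_le {n : ℕ} {P : ℝ[X]} (hdeg : P.natDegree ≤ n) {M : ℝ}
    (hM : 0 < M) (hP : ∀ x ∈ Set.Icc (-1) 1, |P.eval x| ≤ M) {x : ℝ}
    (hx : x ∈ Set.Icc (-1) 1) :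
    |(derivative (derivative P)).eval x| ≤ M * ((n : ℝ) ^ 2 * ((n : ℝ) ^ 2 - 1) / 3) := by
  have key : ∀ c : ℝ, |c| = M⁻¹ → c * (derivative (derivative P)).eval x ≤
      (n : ℝ) ^ 2 * ((n : ℝ) ^ 2 - 1) / 3 := by
    intro c hc
    have h := eval_derivative_derivative_le (P := Polynomial.C c * P)
      ((natDegree_C_mul_le _ _).trans hdeg) (fun y hy => by
        rw [eval_mul, eval_C, abs_mul, hc, inv_mul_le_one₀ hM]
        exact hP y hy) hx
    simpa [derivative_C_mul] using h
  have h1 := key M⁻¹ (abs_of_pos (by positivity))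
  have h2 := key (-M⁻¹) (by rw [abs_neg]; exact abs_of_pos (by positivity))
  rw [inv_mul_le_iff₀ hM] at h1
  rw [neg_mul, ← mul_neg, inv_mul_le_iff₀ hM] at h2
  exact abs_le.2 ⟨by linarith, h1⟩

end Polynomial.Chebyshev

/-! ### Integrals of the positive part of a polynomial with bounded derivative -/

section PositivePart

variable {f : ℝ[X]} {a b M : ℝ}

theorem Polynomial.continuous_max_eval_zero (f : ℝ[X]) :
    Continuous fun x => max (f.eval x) 0 :=
  f.continuous.max continuous_const

theorem Polynomial.eval_sub_eval_le_of_abs_derivative_le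
    (hM : ∀ x ∈ Set.Icc a b, |(derivative f).eval x| ≤ M) {x y : ℝ}
    (hx : x ∈ Set.Icc a b) (hy : y ∈ Set.Icc a b) : f.eval y - f.eval x ≤ M * |y - x| := by
  have h := Convex.norm_image_sub_le_of_norm_hasDerivWithin_le (s := Set.Icc a b) (C := M)
    (fun z _ => (f.hasDerivAt z).hasDerivWithinAt) hM (convex_Icc a b) hx hy
  exact (le_abs_self _).trans h

theorem Polynomial.integral_max_eval_zero_le_of_right (hab : a ≤ b)
    (hM : ∀ x ∈ Set.Icc a b, |(derivative f).eval x| ≤ M) (hb : f.eval b ≤ 0) :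
    ∫ x in a..b, max (f.eval x) 0 ≤ M * (b - a) ^ 2 / 2 := by
  have hM0 : 0 ≤ M := (abs_nonneg _).trans (hM a (Set.left_mem_Icc.2 hab))
  have e : ∫ x in a..b, M * (b - x) = M * (b - a) ^ 2 / 2 := by
    rw [intervalIntegral.integral_const_mul, intervalIntegral.integral_comp_sub_left (fun x => x) b,
      integral_id]
    ring
  rw [← e]
  refine intervalIntegral.integral_mono_on hab (f.continuous_max_eval_zero.intervalIntegrable _ _)
    (Continuous.intervalIntegrable (by fun_prop) _ _) fun x hx => ?_
  have h := eval_sub_eval_le_of_abs_derivative_le hM (Set.right_mem_Icc.2 hab) hx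
  rw [abs_sub_comm, abs_of_nonneg (sub_nonneg.2 hx.2)] at h
  exact max_le (by linarith) (mul_nonneg hM0 (sub_nonneg.2 hx.2))

theorem Polynomial.integral_max_eval_zero_le_of_left (hab : a ≤ b)
    (hM : ∀ x ∈ Set.Icc a b, |(derivative f).eval x| ≤ M) (ha : f.eval a ≤ 0) :
    ∫ x in a..b, max (f.eval x) 0 ≤ M * (b - a) ^ 2 / 2 := by
  have hM0 : 0 ≤ M := (abs_nonneg _).trans (hM a (Set.left_mem_Icc.2 hab))
  have e : ∫ x in a..b, M * (x - a) = M * (b - a) ^ 2 / 2 := by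
    rw [intervalIntegral.integral_const_mul, intervalIntegral.integral_comp_sub_right (fun x => x) a,
      integral_id]
    ring
  rw [← e]
  refine intervalIntegral.integral_mono_on hab (f.continuous_max_eval_zero.intervalIntegrable _ _)
    (Continuous.intervalIntegrable (by fun_prop) _ _) fun x hx => ?_
  have h := eval_sub_eval_le_of_abs_derivative_le hM (Set.left_mem_Icc.2 hab) hx
  rw [abs_of_nonneg (sub_nonneg.2 hx.1)] at h
  exact max_le (by linarith) (mul_nonneg hM0 (sub_nonneg.2 hx.1))

/-- The positive part lies under a tent of slopes ±M; its two halves are the one-sided bounds on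
half the interval. -/
theorem Polynomial.integral_max_eval_zero_le_of_both (hab : a ≤ b)
    (hM : ∀ x ∈ Set.Icc a b, |(derivative f).eval x| ≤ M) (ha : f.eval a ≤ 0)
    (hb : f.eval b ≤ 0) :
    ∫ x in a..b, max (f.eval x) 0 ≤ M * (b - a) ^ 2 / 4 := by
  have hi := fun x y => (f.continuous_max_eval_zero.intervalIntegrable (μ := MeasureTheory.volume) x y)
  rw [← intervalIntegral.integral_add_adjacent_intervals (hi a ((a + b) / 2)) (hi _ b)]
  have h1 := integral_max_eval_zero_le_of_left (f := f) (a := a) (b := (a + b) / 2) (by linarith)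
    (fun x hx => hM x ⟨hx.1, by linarith [hx.2]⟩) ha
  have h2 := integral_max_eval_zero_le_of_right (f := f) (a := (a + b) / 2) (b := b) (by linarith)
    (fun x hx => hM x ⟨by linarith [hx.1], hx.2⟩) hb
  linarith

theorem Polynomial.integral_max_eval_zero_nonpos (hab : a ≤ b)
    (h : ∀ x ∈ Set.Ioo a b, f.eval x ≤ 0) : ∫ x in a..b, max (f.eval x) 0 ≤ 0 := by
  have := intervalIntegral.integral_mono_on_of_le_Ioo hab
    (f.continuous_max_eval_zero.intervalIntegrable (μ := MeasureTheory.volume) a b)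
    (intervalIntegrable_const (c := (0 : ℝ))) (fun x hx => max_le (h x hx) le_rfl)
  simpa using this

theorem Polynomial.eval_sub_eval_le_integral_max_derivative (q : ℝ[X]) (hab : a ≤ b) :
    q.eval b - q.eval a ≤ ∫ x in a..b, max ((derivative q).eval x) 0 := by
  rw [← intervalIntegral.integral_eq_sub_of_hasDerivAt (fun x _ => q.hasDerivAt x)
    ((derivative q).continuous.intervalIntegrable _ _)]
  exact intervalIntegral.integral_mono_on hab ((derivative q).continuous.intervalIntegrable _ _)
    ((derivative q).continuous_max_eval_zero.intervalIntegrable _ _) fun x _ => le_max_left _ _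

end PositivePart

/-! ### Root counting, total increase and the excluded polynomial -/

/-- If `f` is nonpositive at `1, …, k`, then each of the intervals `(j, j + 1)` on which `f` takes
a positive value accounts for two roots of `f - ε`, or one if `j = 0`. -/
theorem Polynomial.card_add_card_erase_le_natDegree {f : ℝ[X]} {k : ℕ} (hk : 0 < k)
    (hf : ∀ j : ℕ, 1 ≤ j → j ≤ k → f.eval (j : ℝ) ≤ 0) {S : Finset ℕ}
    (hS : ∀ j ∈ S, j < k ∧ ∃ x ∈ Set.Ioo (j : ℝ) (j + 1), 0 < f.eval x) :
    S.card + (S.erase 0).card ≤ f.natDegree := by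
  rcases S.eq_empty_or_nonempty with rfl | hne
  · simp
  have hS' : ∀ j : ℕ, ∃ x : ℝ, j ∈ S → x ∈ Set.Ioo (j : ℝ) (j + 1) ∧ 0 < f.eval x := by
    intro j
    by_cases hj : j ∈ S
    · obtain ⟨x, hx⟩ := (hS j hj).2
      exact ⟨x, fun _ => hx⟩
    · exact ⟨0, fun h => absurd h hj⟩
  choose x hx using hS'
  -- Lowering f by ε makes it strictly negative at 1, …, k, so roots lie in the open intervals and
  -- none is shared by neighbours. Nothing is known at 0, hence no left root for j = 0.
  obtain ⟨ε, hε, hεx⟩ : ∃ ε > 0, ∀ j ∈ S, ε < f.eval (x j) := by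
    obtain ⟨m, hm, hmin⟩ := S.exists_min_image (fun j => f.eval (x j)) hne
    have := (hx m hm).2
    exact ⟨f.eval (x m) / 2, by linarith, fun j hj => by linarith [hmin j hj]⟩
  set g := f - C ε with hg
  have hge : ∀ y, g.eval y = f.eval y - ε := fun y => by simp [hg]
  have hg0 : g ≠ 0 := by
    intro h
    have h1 := hge k
    rw [h, eval_zero] at h1
    linarith [hf k hk le_rfl]
  have hr : ∀ j : ℕ, ∃ y : ℝ, j ∈ S → y ∈ Set.Ioo (x j) (j + 1) ∧ g.eval y = 0 := by
    intro j
    by_cases hj : j ∈ S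
    · have h1 := hf (j + 1) (by omega) (hS j hj).1
      push_cast at h1
      obtain ⟨y, hy, h⟩ := intermediate_value_Ioo' (hx j hj).1.2.le (g.continuous.continuousOn)
        (show (0 : ℝ) ∈ Set.Ioo _ _ from
          ⟨by rw [hge]; linarith, by rw [hge]; linarith [hεx j hj]⟩)
      exact ⟨y, fun _ => ⟨hy, h⟩⟩
    · exact ⟨0, fun h => absurd h hj⟩
  have hl : ∀ j : ℕ, ∃ y : ℝ, j ∈ S.erase 0 → y ∈ Set.Ioo (j : ℝ) (x j) ∧ g.eval y = 0 := by
    intro j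
    by_cases hj : j ∈ S.erase 0
    · have hj' := Finset.mem_erase.1 hj
      have h1 := hf j (by omega) (hS j hj'.2).1.le
      obtain ⟨y, hy, h⟩ := intermediate_value_Ioo (hx j hj'.2).1.1.le (g.continuous.continuousOn)
        (show (0 : ℝ) ∈ Set.Ioo _ _ from
          ⟨by rw [hge]; linarith, by rw [hge]; linarith [hεx j hj'.2]⟩)
      exact ⟨y, fun _ => ⟨hy, h⟩⟩
    · exact ⟨0, fun h => absurd h hj⟩
  choose r hr using hr
  choose l hl using hl
  have hrI : ∀ j ∈ S, (j : ℝ) < r j ∧ r j < j + 1 := fun j hj =>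
    ⟨(hx j hj).1.1.trans (hr j hj).1.1, (hr j hj).1.2⟩
  have hlI : ∀ j ∈ S.erase 0, (j : ℝ) < l j ∧ l j < j + 1 := fun j hj =>
    ⟨(hl j hj).1.1, (hl j hj).1.2.trans (hx j (Finset.mem_of_mem_erase hj)).1.2⟩
  have huniq : ∀ (i j : ℕ) (y : ℝ), (i : ℝ) < y → y < i + 1 → (j : ℝ) < y → y < j + 1 → i = j := by
    intro i j y h1 h2 h3 h4
    have h5 : (i : ℝ) < (j + 1 : ℕ) := by push_cast; linarith
    have h6 : (j : ℝ) < (i + 1 : ℕ) := by push_cast; linarith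
    have h5 := Nat.cast_lt.1 h5
    have h6 := Nat.cast_lt.1 h6
    omega
  have hrinj : Set.InjOn r S := fun i hi j hj h => by
    have h1 := hrI i hi
    have h2 := hrI j hj
    rw [← h] at h2
    exact huniq i j _ h1.1 h1.2 h2.1 h2.2
  have hlinj : Set.InjOn l (S.erase 0 : Finset ℕ) := fun i hi j hj h => by
    have h1 := hlI i hi
    have h2 := hlI j hj
    rw [← h] at h2
    exact huniq i j _ h1.1 h1.2 h2.1 h2.2
  have hdisj : Disjoint (S.image r) ((S.erase 0).image l) := by
    rw [Finset.disjoint_left]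
    intro y hy hy'
    obtain ⟨i, hi, rfl⟩ := Finset.mem_image.1 hy
    obtain ⟨j, hj, h⟩ := Finset.mem_image.1 hy'
    have h1 := hrI i hi
    have h2 := hlI j hj
    rw [h] at h2
    obtain rfl := huniq i j _ h1.1 h1.2 h2.1 h2.2
    exact absurd h (((hl i hj).1.2).trans (hr i hi).1.1).ne
  rw [← Finset.card_image_of_injOn hrinj, ← Finset.card_image_of_injOn hlinj,
    ← Finset.card_union_of_disjoint hdisj, ← natDegree_sub_C (a := ε)]
  have hsub : S.image r ∪ (S.erase 0).image l ⊆ g.roots.toFinset := by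
    intro y hy
    rw [Multiset.mem_toFinset, mem_roots hg0, IsRoot.def]
    rcases Finset.mem_union.1 hy with hy | hy
    · obtain ⟨i, hi, rfl⟩ := Finset.mem_image.1 hy
      exact (hr i hi).2
    · obtain ⟨i, hi, rfl⟩ := Finset.mem_image.1 hy
      exact (hl i hi).2
  exact (Finset.card_le_card hsub).trans ((Multiset.toFinset_card_le _).trans (card_roots' g))

/-- The total increase of `q` on `[0, k]`, when `q` has nonpositive derivative at `1, …, k`. -/
theorem Polynomial.integral_max_derivative_le {q : ℝ[X]} {p k : ℕ} (hk : 0 < k)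
    (hp : 0 < p) (hdeg : q.natDegree ≤ p)
    (hq : ∀ j : ℕ, 1 ≤ j → j ≤ k → (derivative q).eval (j : ℝ) ≤ 0) {M : ℝ}
    (hM : ∀ x ∈ Set.Icc (0 : ℝ) k, |(derivative (derivative q)).eval x| ≤ M) :
    ∫ x in (0 : ℝ)..k, max ((derivative q).eval x) 0 ≤ M / 4 * ((p + 2) / 2 : ℕ) := by
  classical
  have hM0 : 0 ≤ M := (abs_nonneg _).trans (hM 0 ⟨le_rfl, by positivity⟩)
  set f := derivative q with hf
  let S := (Finset.range k).filter fun j : ℕ => ∃ x ∈ Set.Ioo (j : ℝ) (j + 1), 0 < f.eval x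
  have hcard := card_add_card_erase_le_natDegree hk hq (S := S) fun j hj => by
    simpa [S] using hj
  have hfd : f.natDegree ≤ p - 1 := (natDegree_derivative_le q).trans (by omega)
  have hsum := intervalIntegral.sum_integral_adjacent_intervals (n := k) (a := fun j : ℕ => (j : ℝ))
    (f := fun x => max (f.eval x) 0) (μ := MeasureTheory.volume)
    fun j _ => f.continuous_max_eval_zero.intervalIntegrable _ _
  rw [Nat.cast_zero] at hsum
  rw [← hsum]
  have hM' : ∀ j < k, ∀ x ∈ Set.Icc (j : ℝ) ((j + 1 : ℕ) : ℝ), |(derivative f).eval x| ≤ M := by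
    intro j hj x hx
    have : ((j + 1 : ℕ) : ℝ) ≤ k := by exact_mod_cast hj
    exact hM x ⟨(Nat.cast_nonneg j).trans hx.1, hx.2.trans this⟩
  -- The one-sided bound M/2 on (0, 1) is booked as two shares of M/4; the root saved there pays for
  -- the second share.
  have hterm : ∀ j ∈ Finset.range k, ∫ x in (j : ℝ)..((j + 1 : ℕ) : ℝ), max (f.eval x) 0 ≤
      (if j ∈ S then M / 4 else 0) + (if j ∈ S then if j = 0 then M / 4 else 0 else 0) := by
    intro j hj
    have hj := Finset.mem_range.1 hj
    have hle : (j : ℝ) ≤ ((j + 1 : ℕ) : ℝ) := by push_cast; linarith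
    have hlen : (((j + 1 : ℕ) : ℝ) - j) ^ 2 = 1 := by push_cast; ring
    by_cases hjS : j ∈ S
    · by_cases hj0 : j = 0
      · have := integral_max_eval_zero_le_of_right hle (hM' j hj) (hq (j + 1) (by omega) hj)
        rw [hlen] at this
        rw [if_pos hjS, if_pos hjS, if_pos hj0]
        linarith
      · have := integral_max_eval_zero_le_of_both hle (hM' j hj) (hq j (by omega) hj.le)
          (hq (j + 1) (by omega) hj)
        rw [hlen] at this
        simp only [hjS, hj0, if_true, if_false]
        linarith
    · simp only [hjS, if_false, add_zero]
      refine integral_max_eval_zero_nonpos hle fun x hx => ?_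
      by_contra! hcon
      refine hjS (Finset.mem_filter.2 ⟨Finset.mem_range.2 hj, x, ?_, hcon⟩)
      simpa using hx
  refine (Finset.sum_le_sum hterm).trans ?_
  have hSk : (Finset.range k).filter (· ∈ S) = S := by
    ext j; simp only [Finset.mem_filter, S]; tauto
  rw [Finset.sum_add_distrib, ← Finset.sum_filter, ← Finset.sum_filter, hSk, Finset.sum_const,
    Finset.sum_ite_eq', nsmul_eq_mul]
  by_cases h0 : 0 ∈ S
  · rw [if_pos h0]
    rw [Finset.card_erase_of_mem h0] at hcard
    have hc : S.card + 1 ≤ (p + 2) / 2 := by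
      have := Finset.card_pos.2 ⟨0, h0⟩
      omega
    have hc' : (S.card : ℝ) + 1 ≤ ((p + 2) / 2 : ℕ) := by exact_mod_cast hc
    nlinarith
  · rw [if_neg h0]
    rw [Finset.erase_eq_of_notMem h0] at hcard
    have hc : S.card ≤ (p + 2) / 2 := by omega
    have hc' : (S.card : ℝ) ≤ ((p + 2) / 2 : ℕ) := by exact_mod_cast hc
    nlinarith

/-- Subtracting the midpoint of the range halves the sup bound to D/2; the affine map from [-1, 1]
to [0, L] contributes (2/L)². -/
theorem Polynomial.abs_derivative_derivative_le_of_mem_Icc {q : ℝ[X]} {p : ℕ}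
    (hdeg : q.natDegree ≤ p) {L m D : ℝ} (hL : 0 < L) (hD : 0 < D)
    (hq : ∀ x ∈ Set.Icc 0 L, q.eval x ∈ Set.Icc m (m + D)) {x : ℝ} (hx : x ∈ Set.Icc 0 L) :
    |(derivative (derivative q)).eval x| ≤
      (2 / L) ^ 2 * (D / 2 * ((p : ℝ) ^ 2 * ((p : ℝ) ^ 2 - 1) / 3)) := by
  set A : ℝ[X] := C (L / 2) * (X + 1) with hA
  set P : ℝ[X] := (q - C (m + D / 2)).comp A with hP
  have hPd : P.natDegree ≤ p := by
    have h1 : A.natDegree ≤ 1 :=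
      (natDegree_C_mul_le _ _).trans (natDegree_add_le_of_degree_le natDegree_X_le (by simp))
    rw [hP]
    refine natDegree_comp_le.trans ?_
    rw [natDegree_sub_C]
    calc q.natDegree * A.natDegree ≤ p * 1 := Nat.mul_le_mul hdeg h1
      _ = p := mul_one p
  have hAe : ∀ y, A.eval y = L / 2 * (y + 1) := fun y => by simp [hA]
  have hb : ∀ y ∈ Set.Icc (-1 : ℝ) 1, |P.eval y| ≤ D / 2 := by
    intro y hy
    have h := hq (L / 2 * (y + 1)) ⟨mul_nonneg (by positivity) (by linarith [hy.1]),
      by nlinarith [hy.2]⟩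
    rw [hP, eval_comp, hAe, eval_sub, eval_C]
    exact abs_le.2 ⟨by linarith [h.1], by linarith [h.2]⟩
  have hd : derivative (derivative P) =
      C ((L / 2) ^ 2) * (derivative (derivative q)).comp A := by
    have hdA : derivative A = C (L / 2) := by simp [hA]
    rw [hP, derivative_comp, hdA, derivative_C_mul, derivative_comp, hdA, derivative_sub,
      derivative_C, sub_zero, ← mul_assoc, ← C_mul, sq]
  have hy : 2 / L * x - 1 ∈ Set.Icc (-1 : ℝ) 1 := by
    have h1 : 0 ≤ 2 / L * x := mul_nonneg (by positivity) hx.1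
    have h2 : 2 / L * x ≤ 2 / L * L := mul_le_mul_of_nonneg_left hx.2 (by positivity)
    have h3 : 2 / L * L = 2 := by field_simp
    exact ⟨by linarith, by linarith⟩
  have key := Chebyshev.abs_eval_derivative_derivative_le hPd (by positivity) hb hy
  have hAx : L / 2 * (2 / L * x - 1 + 1) = x := by field_simp; ring
  rw [hd, eval_mul, eval_C, eval_comp, hAe, hAx, abs_mul, abs_of_nonneg (sq_nonneg _)] at key
  have hLL : (2 / L) ^ 2 * (L / 2) ^ 2 = 1 := by field_simp
  calc |(derivative (derivative q)).eval x|
      = (2 / L) ^ 2 * ((L / 2) ^ 2 * |(derivative (derivative q)).eval x|) := by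
        rw [← mul_assoc, hLL, one_mul]
    _ ≤ _ := by gcongr

/-- There is no nonzero polynomial `q` of degree at most `p` with `q 0 ≤ 0`, which is nonnegative
with nonpositive derivative at `1, …, k`, if `k` is large compared to `p`. -/
theorem Polynomial.eq_zero_of_sign_conditions {q : ℝ[X]} {p k : ℕ} (hk : 0 < k) (hp : 0 < p)
    (hdeg : q.natDegree ≤ p)
    (hkp : (p : ℝ) ^ 2 * ((p : ℝ) ^ 2 - 1) / 6 * ((p + 2) / 2 : ℕ) < (k : ℝ) ^ 2)
    (h0 : q.eval 0 ≤ 0) (hq : ∀ j : ℕ, 1 ≤ j → j ≤ k → 0 ≤ q.eval (j : ℝ))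
    (hq' : ∀ j : ℕ, 1 ≤ j → j ≤ k → (derivative q).eval (j : ℝ) ≤ 0) : q = 0 := by
  have hk0 : (0 : ℝ) < k := by exact_mod_cast hk
  have hqk := hq k hk le_rfl
  obtain ⟨a, ha, hmin⟩ := isCompact_Icc.exists_isMinOn (Set.nonempty_Icc.2 hk0.le)
    q.continuous.continuousOn
  obtain ⟨b, hb, hmax⟩ := isCompact_Icc.exists_isMaxOn (Set.nonempty_Icc.2 hk0.le)
    q.continuous.continuousOn
  have hmin : ∀ x ∈ Set.Icc (0 : ℝ) k, q.eval a ≤ q.eval x := hmin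
  have hmax : ∀ x ∈ Set.Icc (0 : ℝ) k, q.eval x ≤ q.eval b := hmax
  rcases le_or_gt (q.eval b) (q.eval a) with hD | hD
  · have hz : ∀ x ∈ Set.Icc (0 : ℝ) k, q.eval x = 0 := by
      intro x hx
      have h1 := hmin x hx
      have h2 := hmax x hx
      have h3 := hmin 0 ⟨le_rfl, hk0.le⟩
      have h4 := hmax k ⟨hk0.le, le_rfl⟩
      linarith [hmin k ⟨hk0.le, le_rfl⟩, hmax 0 ⟨le_rfl, hk0.le⟩]
    exact eq_zero_of_infinite_isRoot q ((Set.Icc_infinite hk0).mono hz)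
  exfalso
  set D := q.eval b - q.eval a with hDd
  have hDpos : 0 < D := sub_pos.2 hD
  have hM := fun x (hx : x ∈ Set.Icc (0 : ℝ) k) =>
    abs_derivative_derivative_le_of_mem_Icc hdeg hk0 hDpos (m := q.eval a)
      (fun y hy => ⟨hmin y hy, by rw [hDd]; linarith [hmax y hy]⟩) hx
  have hV := integral_max_derivative_le hk hp hdeg hq' hM
  have hi := fun x y =>
    ((derivative q).continuous_max_eval_zero.intervalIntegrable (μ := MeasureTheory.volume) x y)
  have hnn : ∀ x y : ℝ, x ≤ y → 0 ≤ ∫ z in x..y, max ((derivative q).eval z) 0 := fun x y h =>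
    intervalIntegral.integral_nonneg h fun z _ => le_max_right _ _
  -- If the maximum precedes the minimum, the rises on [0, b] and [a, k] add up to D + q(k) - q(0) ≥
  -- D.
  have hDV : D ≤ ∫ x in (0 : ℝ)..k, max ((derivative q).eval x) 0 := by
    rcases le_total a b with hab | hab
    · rw [← intervalIntegral.integral_add_adjacent_intervals (hi 0 a) (hi a k),
        ← intervalIntegral.integral_add_adjacent_intervals (hi a b) (hi b k)]
      linarith [hnn 0 a ha.1, hnn b k hb.2, eval_sub_eval_le_integral_max_derivative q hab]
    · rw [← intervalIntegral.integral_add_adjacent_intervals (hi 0 b) (hi b k),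
        ← intervalIntegral.integral_add_adjacent_intervals (hi b a) (hi a k)]
      linarith [hnn b a hab, eval_sub_eval_le_integral_max_derivative q hb.1,
        eval_sub_eval_le_integral_max_derivative q ha.2]
  have h1 := hDV.trans hV
  have h2 : (2 / (k : ℝ)) ^ 2 * (D / 2 * ((p : ℝ) ^ 2 * ((p : ℝ) ^ 2 - 1) / 3)) / 4 *
      ((p + 2) / 2 : ℕ) =
      D * ((p : ℝ) ^ 2 * ((p : ℝ) ^ 2 - 1) / 6 * ((p + 2) / 2 : ℕ)) / (k : ℝ) ^ 2 := by
    field_simp; ring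
  rw [h2, le_div_iff₀ (by positivity)] at h1
  exact absurd (le_of_mul_le_mul_left h1 hDpos) (not_le.2 hkp)

/-! ### Duality with strictly positive coefficients -/

/-- If no nonzero linear functional is nonnegative on the vectors `v i` and nonpositive at `e`, then
`e` is a combination of the `v i` with positive coefficients. -/
theorem exists_pos_sum_smul_eq_of_forall_dual {ι E : Type*} [Fintype ι] [NormedAddCommGroup E]
    [NormedSpace ℝ E] [FiniteDimensional ℝ E] (v : ι → E) (e : E)
    (h : ∀ f : E →ₗ[ℝ] ℝ, (∀ i, 0 ≤ f (v i)) → f e ≤ 0 → f = 0) :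
    ∃ c : ι → ℝ, (∀ i, 0 < c i) ∧ ∑ i, c i • v i = e := by
  classical
  let A : (ι → ℝ) →ₗ[ℝ] E := Fintype.linearCombination ℝ v
  have hA : ∀ c, A c = ∑ i, c i • v i := fun c => Fintype.linearCombination_apply ℝ v c
  have hA1 : ∀ i, A (Pi.single i 1) = v i := fun i => by
    rw [Fintype.linearCombination_apply_single, one_smul]
  -- A functional vanishing on the range satisfies the hypothesis up to sign. Surjectivity makes the
  -- image of the open orthant open, so it can be separated strictly from e.
  have hsurj : Function.Surjective A := by
    rw [← LinearMap.range_eq_top]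
    by_contra hne
    obtain ⟨f, hf0, hf⟩ := Submodule.exists_le_ker_of_lt_top _ (lt_top_iff_ne_top.2 hne)
    have hv : ∀ i, f (v i) = 0 := fun i => hf ⟨Pi.single i 1, hA1 i⟩
    rcases le_total (f e) 0 with he | he
    · exact hf0 (h f (fun i => (hv i).ge) he)
    · refine hf0 (neg_eq_zero.1 (h (-f) (fun i => ?_) ?_))
      · simp [hv i]
      · simpa using he
  let O : Set (ι → ℝ) := Set.univ.pi fun _ => Set.Ioi 0
  have hOmem : ∀ c, c ∈ O ↔ ∀ i, 0 < c i := fun c => by simp [O]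
  have hOopen : IsOpen O := isOpen_set_pi Set.finite_univ fun _ _ => isOpen_Ioi
  have hOconv : Convex ℝ O := convex_pi fun _ _ => convex_Ioi 0
  have himg : IsOpen (A '' O) := A.isOpenMap_of_finiteDimensional hsurj _ hOopen
  by_cases he : e ∈ A '' O
  · obtain ⟨c, hc, hce⟩ := he
    exact ⟨c, (hOmem c).1 hc, (hA c).symm.trans hce⟩
  exfalso
  obtain ⟨f, hf⟩ := geometric_hahn_banach_open_point (hOconv.linear_image A) himg he
  have hlt : ∀ c : ι → ℝ, (∀ i, 0 < c i) → f (A c) < f e := fun c hc =>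
    hf _ ⟨c, (hOmem c).2 hc, rfl⟩
  have hscale : ∀ (c : ι → ℝ), (∀ i, 0 < c i) → ∀ t : ℝ, 0 < t → t * f (A c) < f e := by
    intro c hc t ht
    have := hlt (t • c) fun i => mul_pos ht (hc i)
    rwa [map_smul, map_smul, smul_eq_mul] at this
  have hcone : ∀ c : ι → ℝ, (∀ i, 0 < c i) → f (A c) ≤ 0 := by
    intro c hc
    by_contra! hpos
    have := hscale c hc ((|f e| + 1) / f (A c)) (by positivity)
    rw [div_mul_cancel₀ _ hpos.ne'] at this
    linarith [le_abs_self (f e)]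
  have hfe : 0 ≤ f e := by
    by_contra! hneg
    -- The scale is small enough that t f(A 1) ≥ f(e)/2 > f(e); the -1 keeps the denominator
    -- nonzero.
    have h1 := hscale 1 (fun _ => one_pos) (f e / (2 * (f (A 1) - 1)))
      (div_pos_of_neg_of_neg hneg (by linarith [hcone 1 fun _ => one_pos]))
    have hc := hcone 1 fun _ => one_pos
    rw [div_mul_eq_mul_div, div_lt_iff_of_neg (by linarith)] at h1
    nlinarith
  have hv : ∀ i, f (v i) ≤ 0 := by
    intro i
    by_contra! hpos
    have hc := fun t (ht : (0 : ℝ) < t) => hcone (t • Pi.single i 1 + 1) fun j => by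
      by_cases hj : j = i
      · subst hj; simp; positivity
      · simp [hj]
    have := hc ((|f (A 1)| + 1) / f (v i)) (by positivity)
    rw [map_add, map_smul, map_add, map_smul, hA1, smul_eq_mul, div_mul_cancel₀ _ hpos.ne'] at this
    linarith [neg_abs_le (f (A 1))]
  have hzero := h (-(f : E →ₗ[ℝ] ℝ)) (fun i => by simpa using hv i) (by simpa using hfe)
  have hz : ∀ x, f x = 0 := fun x => by
    have := LinearMap.congr_fun hzero x
    simpa using this
  have := hlt 1 fun _ => one_pos
  rw [hz, hz] at this
  exact lt_irrefl _ this

/-! ### From the dual polynomial to a multistep method -/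

namespace LinearMultistepMethod

variable {k : ℕ}

theorem sspCoeff_pos_of_pos (M : LinearMultistepMethod k) (hα : ∀ i, 0 < M.α i)
    (hβ : ∀ i : Fin k, 0 < M.β i.succ) (h0 : M.β 0 = 0) : 0 < M.sspCoeff := by
  have hN : M.Nonneg := ⟨fun i => (hα i).le, Fin.cases h0.ge fun i => (hβ i).le⟩
  rw [sspCoeff, if_pos hN]
  rcases isEmpty_or_nonempty (Fin k) with he | hne
  · rw [iInf_of_empty]
    exact ENNReal.zero_lt_top
  obtain ⟨m, hm⟩ := Finite.exists_min fun i : Fin k => M.α i / M.β i.succ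
  refine (ENNReal.ofReal_pos.2 (div_pos (hα m) (hβ m))).trans_le ?_
  exact le_iInf₂ fun i _ => ENNReal.ofReal_le_ofReal (hm i)

/-- A functional on ℝ^(p+1) is a polynomial q of degree at most p via its coefficients. The columns
of `α` and `β` then pair to q(j) and -q'(j), and the right-hand side to q(0), since 0^0 = 1. -/
theorem exists_isExplicit_hasOrder_pos {p : ℕ} (hk : 0 < k) (hp : 0 < p)
    (hkp : (p : ℝ) ^ 2 * ((p : ℝ) ^ 2 - 1) / 6 * ((p + 2) / 2 : ℕ) < (k : ℝ) ^ 2) :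
    ∃ M : LinearMultistepMethod k, M.IsExplicit ∧ M.HasOrder p ∧ 0 < M.sspCoeff := by
  let v : Fin k ⊕ Fin k → Fin (p + 1) → ℝ := Sum.elim
    (fun i m => ((i : ℕ) + 1 : ℝ) ^ (m : ℕ))
    (fun i m => -((m : ℕ) * ((i : ℕ) + 1 : ℝ) ^ ((m : ℕ) - 1)))
  obtain ⟨c, hc, hsum⟩ := exists_pos_sum_smul_eq_of_forall_dual v (Pi.single 0 1) (by
    intro f hf he
    let q : ℝ[X] := ∑ m : Fin (p + 1), C (f (Pi.single m 1)) * X ^ (m : ℕ)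
    have hfx : ∀ x : Fin (p + 1) → ℝ, f x = ∑ m, f (Pi.single m 1) * x m := by
      intro x
      conv_lhs => rw [pi_eq_sum_univ' x]
      rw [map_sum]
      refine Finset.sum_congr rfl fun m _ => ?_
      rw [map_smul, smul_eq_mul, mul_comm]
    have hqe : ∀ x : ℝ, q.eval x = f fun m => x ^ (m : ℕ) := fun x => by
      rw [hfx]; simp [q, eval_finsetSum]
    have hqe' : ∀ x : ℝ, (derivative q).eval x =
        -f fun m => -((m : ℕ) * x ^ ((m : ℕ) - 1)) := fun x => by
      rw [hfx, ← Finset.sum_neg_distrib]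
      simp [q, eval_finsetSum, derivative_X_pow]
    have hq0 : q.eval 0 = f (Pi.single 0 1) := by
      rw [hqe]
      congr 1
      ext m
      refine Fin.cases ?_ (fun j => ?_) m <;> simp
    have hdeg : q.natDegree ≤ p := natDegree_sum_le_of_forall_le _ _ fun m _ =>
      (natDegree_C_mul_X_pow_le _ _).trans (Nat.lt_succ_iff.1 m.2)
    have hz : q = 0 := by
      refine eq_zero_of_sign_conditions hk hp hdeg hkp (hq0.trans_le he) ?_ ?_
      · intro j hj hjk
        have := hf (Sum.inl ⟨j - 1, by omega⟩)
        rw [hqe]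
        simpa [v, Nat.cast_sub hj] using this
      · intro j hj hjk
        have := hf (Sum.inr ⟨j - 1, by omega⟩)
        rw [hqe', neg_nonpos]
        simpa [v, Nat.cast_sub hj] using this
    refine LinearMap.pi_ext' fun m => LinearMap.ext_ring ?_
    have hcoeff : q.coeff (m : ℕ) = f (Pi.single m 1) := by
      simp only [q, finsetSum_coeff, coeff_C_mul, coeff_X_pow]
      rw [Finset.sum_eq_single m]
      · simp
      · intro b _ hb
        rw [if_neg (fun h => hb (Fin.ext h.symm)), mul_zero]
      · simp
    rw [hz, coeff_zero] at hcoeff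
    simpa using hcoeff.symm)
  refine ⟨⟨fun i => c (Sum.inl i), Fin.cons 0 fun i => c (Sum.inr i)⟩, rfl, ⟨?_, ?_⟩, ?_⟩
  · have := congrFun hsum 0
    simpa [v, Fintype.sum_sum_type, Finset.sum_apply] using this
  · intro m hm hmp
    have := congrFun hsum ⟨m, by omega⟩
    have hm0 : (⟨m, by omega⟩ : Fin (p + 1)) ≠ 0 := by
      simp [Fin.ext_iff]; omega
    rw [Pi.single_eq_of_ne hm0] at this
    simp only [Fin.cons_succ, Fin.cons_zero, mul_zero, sub_zero]
    rw [Fintype.sum_sum_type, Pi.add_apply, Finset.sum_apply, Finset.sum_apply,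
      ← Finset.sum_add_distrib] at this
    rw [← this]
    refine Finset.sum_congr rfl fun i _ => ?_
    simp only [v, Sum.elim_inl, Sum.elim_inr, Pi.smul_apply, smul_eq_mul]
    ring
  · exact sspCoeff_pos_of_pos _ (fun i => hc _) (fun i => by simpa using hc _) rfl

end LinearMultistepMethod

theorem floor_cast_add_two_div_two (p : ℕ) : ⌊((p : ℝ) + 2) / 2⌋₊ = (p + 2) / 2 := by
  have := Nat.floor_div_natCast (K := ℝ) ((p : ℝ) + 2) 2
  have h2 : ⌊(p : ℝ) + 2⌋₊ = p + 2 := by exact_mod_cast Nat.floor_natCast (R := ℝ) (p + 2)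
  rw [h2] at this
  exact_mod_cast this

theorem mainTheorem1 (k p : ℕ) (hk : 0 < k) (hp : 0 < p)
    (hkp : (k : ℝ) > √((p : ℝ) ^ 2 * ((p : ℝ) ^ 2 - 1) / 6 * (⌊((p : ℝ) + 2) / 2⌋₊ : ℝ))) :
    0 < sspCoeffExp k p ∧
      ∃ M : LinearMultistepMethod k, M.IsExplicit ∧ M.HasOrder p ∧ 0 < M.sspCoeff := by
  rw [floor_cast_add_two_div_two, gt_iff_lt, Real.sqrt_lt' (by exact_mod_cast hk)] at hkp
  obtain ⟨M, h1, h2, h3⟩ := LinearMultistepMethod.exists_isExplicit_hasOrder_pos hk hp hkp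
  exact ⟨h3.trans_le (le_iSup₂_of_le M h1 (le_iSup_of_le h2 le_rfl)), M, h1, h2, h3⟩
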